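/- For every integer $m\ge 2$ let a $2^m$-APSK constellation be given by a number of rings $K_m\ge1$, ring sizes $N_k\ge 1$ with $\sum_{k=1}^{K_m}N_k=2^m$, radii $\widetilde r_k>0$ and phase offsets $\phi_k$ ($1\le k\le K_m$; $N_k,\widetilde r_k,\phi_k$ may depend on $m$). Suppose that, as $m\to\infty$ and with constants uniform in $k$, 1. $K_m=\Theta(\sqrt{2^m})$; 2. $\widetilde r_k=\Theta(k/\sqrt{2^m})$ for $1\le k\le K_m$, and $\widetilde r_{k+1}-\widetilde r_k=\Theta(1/\sqrt{2^m})$ for $1\le k\le K_m-1$; 3. for every $m\ge2$ there is an integer $a_m$ with $N_k=a_mk$ for $1\le k\le K_m-1$, and $N_{K_m}=2^m-\sum_{i=1}^{K_m-1}N_i=\Theta(K_m)$; 4. $\phi_{k+1}-\phi_k=0$ for $1\le k\le K_m-1$. Let $\widetilde{\mathcal X}_m=\bigcup_{k=1}^{K_m}\{\widetilde r_k e^{j(\phi_k+2\pi n/N_k)}:0\le n<N_k\}$, and let $\mathcal X_m=\widetilde{\mathcal X}_m/\sqrt{E_m}$ with $E_m=2^{-m}\sum_{x\in\widetilde{\mathcal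 X}_m}|x|^2$ be the normalized constellation. Let $d_{\min}(\mathcal X_m)$ be the least Euclidean distance between points of $\mathcal X_m$ with different labels $(k,n)$. Let $\mathsf X$ be uniformly distributed over $\mathcal X_m$, and let $\mathsf Y_{\rm c}=\sqrt P\,h_{\rm c}\mathsf X+\mathsf Z_{\rm c}$, where $P>0$, $h_{\rm c}\in\mathbb C\setminus\{0\}$ and $\mathsf Z_{\rm c}\sim\mathcal{CN}(0,\sigma_{\rm c}^2)$ is independent of $\mathsf X$, with $\sigma_{\rm c}^2>0$. Put $\mathrm{SNR}_{\rm c}=P|h_{\rm c}|^2/\sigma_{\rm c}^2$. Then: (a) $d_{\min}^2(\mathcal X_m)=\Theta(2^{-m})$ as $m\to\infty$. (b) The family achieves a constant gap to capacity when $m$ is at least $\log_2\mathrm{SNR}_{\rm c}$ up to an additive constant (that is, when $2^m=\Omega(\mathrm{SNR}_{\rm c})$): for every real $\kappa$ there is a constant $G$, independent of $m$, $P$, $h_{\rm c}$, $\sigma_{\rm c}^2$ (hence of $\mathrm{SNR}_{\rm c}$), such that for all $m\ge2$ and all $P,h_{\rm c},\sigma_{\rm c}^2$ as above with $m\ge\log_2\mathrm{SNR}_{\rm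 c}-\kappa$, $$\log_2(1+\mathrm{SNR}_{\rm c})-I(\mathsf X;\mathsf Y_{\rm c})\le G .$$ -/

import Mathlib

open Asymptotics Filter

noncomputable section

/-- The parameters of an amplitude phase shift keying constellation: the number `K` of rings and,
for the rings `k = 1, …, K`, the number `N k` of points, the radius `r k` and the phase
offset `φ k`. Values at other indices `k` play no role. -/
structure APSK where
  K : ℕ
  N : ℕ → ℕ
  r : ℕ → ℝ
  φ : ℕ → ℝ

namespace APSK

/-- The `n`-th point of the `k`-th ring, `r_k e^{j (φ_k + 2 π n / N_k)}`. -/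
def point (A : APSK) (k n : ℕ) : ℂ :=
  (A.r k : ℂ) * Complex.exp (Complex.I * ((A.φ k + 2 * Real.pi * n / A.N k : ℝ) : ℂ))

/-- The constellation, a finite set of complex numbers. -/
def points (A : APSK) : Finset ℂ :=
  (Finset.Icc 1 A.K).biUnion fun k => (Finset.range (A.N k)).image fun n => A.point k n

/-- `A` describes a `2 ^ m`-APSK constellation: at least one ring, nonempty rings of positive
radius, and `2 ^ m` points in total. -/
structure IsAPSK (A : APSK) (m : ℕ) : Prop where
  one_le_K : 1 ≤ A.K
  N_pos : ∀ k, 1 ≤ k → k ≤ A.K → 0 < A.N k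
  r_pos : ∀ k, 1 ≤ k → k ≤ A.K → 0 < A.r k
  sum_N : ∑ k ∈ Finset.Icc 1 A.K, A.N k = 2 ^ m

/-- The average symbol energy `2^{-m} ∑_{x ∈ 𝒳} |x|²` of a `2 ^ m`-APSK constellation. -/
def energy (A : APSK) (m : ℕ) : ℝ :=
  (∑ x ∈ A.points, ‖x‖ ^ 2) / 2 ^ m

/-- The constellation rescaled to unit average symbol energy. -/
def normalized (A : APSK) (m : ℕ) : APSK :=
  { A with r := fun k => A.r k / √(A.energy m) }

/-- The minimum Euclidean distance: the least distance between the points with different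
labels `(k, n) ≠ (k', n')`. -/
def minDist (A : APSK) : ℝ :=
  sInf {d : ℝ | ∃ k n k' n' : ℕ, (1 ≤ k ∧ k ≤ A.K ∧ n < A.N k) ∧
    (1 ≤ k' ∧ k' ≤ A.K ∧ n' < A.N k') ∧ (k, n) ≠ (k', n') ∧
    d = dist (A.point k n) (A.point k' n')}

/-- The scaling laws of the communication-optimal design, for a family with one constellation
`A m` (before normalization) for every `m`. The asymptotic relations are as `m → ∞`, with
constants that are uniform in the ring index `k`. -/
structure IsCommOptimalFamily (A : ℕ → APSK) : Prop where
  isAPSK : ∀ m, 2 ≤ m → (A m).IsAPSK m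
  /-- `K_m = Θ(√(2^m))`. -/
  rings : (fun m => ((A m).K : ℝ)) =Θ[atTop] fun m : ℕ => √((2 : ℝ) ^ m)
  /-- `r_k = Θ(k / √(2^m))` for `1 ≤ k ≤ K_m`. -/
  radius : ∃ c C : ℝ, 0 < c ∧ ∀ᶠ m : ℕ in atTop, ∀ k, 1 ≤ k → k ≤ (A m).K →
    c * (k / √((2 : ℝ) ^ m)) ≤ (A m).r k ∧ (A m).r k ≤ C * (k / √((2 : ℝ) ^ m))
  /-- `r_{k+1} - r_k = Θ(1 / √(2^m))` for `1 ≤ k ≤ K_m - 1`. -/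
  radius_step : ∃ c C : ℝ, 0 < c ∧ ∀ᶠ m : ℕ in atTop, ∀ k, 1 ≤ k → k < (A m).K →
    c * (1 / √((2 : ℝ) ^ m)) ≤ (A m).r (k + 1) - (A m).r k ∧
      (A m).r (k + 1) - (A m).r k ≤ C * (1 / √((2 : ℝ) ^ m))
  /-- `N_k = a_m k` for `1 ≤ k ≤ K_m - 1`; the last ring takes the remaining points, since the
  total number of points is `2 ^ m`. -/
  ring_size : ∃ a : ℕ → ℕ, ∀ m, 2 ≤ m → ∀ k, 1 ≤ k → k < (A m).K → (A m).N k = a m * k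
  /-- `N_{K_m} = Θ(K_m)`. -/
  last_ring : (fun m => ((A m).N (A m).K : ℝ)) =Θ[atTop] fun m => ((A m).K : ℝ)
  /-- The phase offsets are aligned across the rings. -/
  phase : ∀ m, 2 ≤ m → ∀ k, 1 ≤ k → k < (A m).K → (A m).φ (k + 1) - (A m).φ k = 0

end APSK

/-- The conditional density of the output `y` given the input `x` of the complex channel
`Y = √P h X + Z`, where `Z` is circularly symmetric Gaussian of variance `σ2`. -/
def channelDensity (P : ℝ) (h : ℂ) (σ2 : ℝ) (x y : ℂ) : ℝ :=
  1 / (Real.pi * σ2) * Real.exp (-(‖y - (√P : ℂ) * h * x‖ ^ 2 / σ2))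

/-- The mutual information `I(X; Y)` in bits, for `X` uniform over the finite set `S`:
`E_{X,Y} [log₂ (p(Y | X) / ∑_{x' ∈ S} P(x') p(Y | x'))]`. -/
def mutualInfo (S : Finset ℂ) (P : ℝ) (h : ℂ) (σ2 : ℝ) : ℝ :=
  ∑ x ∈ S, 1 / (S.card : ℝ) * ∫ y : ℂ, channelDensity P h σ2 x y *
    Real.logb 2 (channelDensity P h σ2 x y /
      ∑ x' ∈ S, 1 / (S.card : ℝ) * channelDensity P h σ2 x' y)

/-- The signal-to-noise ratio `P |h|² / σ2` of the communication channel. -/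
def snr (P : ℝ) (h : ℂ) (σ2 : ℝ) : ℝ := P * ‖h‖ ^ 2 / σ2

/-- The Gaussian capacity `log₂ (1 + s)` at signal-to-noise ratio `s`. -/
def gaussianCapacity (s : ℝ) : ℝ := Real.logb 2 (1 + s)

end

/-!
For the minimum distance: the multiplier `a_m` of the ring sizes is bounded, because
`Θ(√(2^m))` rings hold only `2^m` points (`exists_ring_size_le`). Hence neighbours on a ring of radius
`Θ(k / √(2^m))` with `O(k)` points are at distance at least a constant times `1 / √(2^m)`, and points
on different rings are at least as far apart as the rings, which is of the same order
(`exists_separated`). In the other direction the first points of the two innermost rings have the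
same argument, so their distance is the radius step. The normalization changes distances by a factor
of order `1` only (`exists_energy_bounds`).

For the gap to capacity: the mutual information is the output entropy minus the noise entropy, and
an upper bound on the output density bounds the output entropy from below
(`le_mutualInfo_of_outputDensity_le`). The output density is an average of Gaussians centred at
separated points. Comparing each Gaussian value with an average over a ball around its centre, and
using that these balls are disjoint, bounds the density by a constant times
`1 / (π σ² |𝒳| d² SNR)` as long as `d² SNR` is bounded (`sum_exp_neg_norm_sub_sq_le`). This gives
`I(X; Y) ≥ log₂ (|𝒳| d² SNR) - O(1)` (`le_mutualInfo_of_separated`), where `|𝒳| = 2^m` and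
`d² = Θ(2^{-m})` make `|𝒳| d²` of order `1`, and `2^m = Ω(SNR)` is what bounds `d² SNR`. At low SNR,
and for the finitely many `m` to which the asymptotic bounds do not apply, nonnegativity of the
mutual information suffices.
-/

section

open MeasureTheory

/-! ### Gaussian integrals over the complex plane -/

lemma integral_exp_neg_norm_sub_sq_div (a : ℂ) {t : ℝ} (ht : 0 < t) :
    ∫ y : ℂ, Real.exp (-(‖y - a‖ ^ 2 / t)) = Real.pi * t := by
  have h := GaussianFourier.integral_rexp_neg_mul_sq_norm (V := ℂ) (b := 1 / t) (by positivity)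
  rw [integral_sub_right_eq_self (fun y : ℂ => Real.exp (-(‖y‖ ^ 2 / t))) a]
  rw [Complex.finrank_real_complex] at h
  convert h using 1
  · congr 1; ext y; congr 1; ring
  · norm_num

lemma integrable_exp_neg_norm_sub_sq_div (a : ℂ) {t : ℝ} (ht : 0 < t) :
    Integrable fun y : ℂ => Real.exp (-(‖y - a‖ ^ 2 / t)) := by
  refine Integrable.of_integral_ne_zero ?_
  rw [integral_exp_neg_norm_sub_sq_div a ht]
  positivity

/-! ### The output density of the channel -/

section Channel

variable {P : ℝ} {h : ℂ} {σ2 : ℝ}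

lemma channelDensity_pos (hσ : 0 < σ2) (x y : ℂ) : 0 < channelDensity P h σ2 x y := by
  unfold channelDensity
  positivity

lemma continuous_channelDensity (x : ℂ) : Continuous (channelDensity P h σ2 x) := by
  unfold channelDensity
  fun_prop

lemma integrable_channelDensity (hσ : 0 < σ2) (x : ℂ) :
    Integrable (channelDensity P h σ2 x) :=
  (integrable_exp_neg_norm_sub_sq_div _ hσ).const_mul _

lemma integral_channelDensity (hσ : 0 < σ2) (x : ℂ) :
    ∫ y, channelDensity P h σ2 x y = 1 := by
  unfold channelDensity
  rw [integral_const_mul, integral_exp_neg_norm_sub_sq_div _ hσ]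
  field_simp

/-- The density of the channel output when the input is uniform over `S`. -/
noncomputable def outputDensity (S : Finset ℂ) (P : ℝ) (h : ℂ) (σ2 : ℝ) (y : ℂ) : ℝ :=
  ∑ x ∈ S, 1 / (S.card : ℝ) * channelDensity P h σ2 x y

variable {S : Finset ℂ}

lemma outputDensity_pos (hS : S.Nonempty) (hσ : 0 < σ2) (y : ℂ) :
    0 < outputDensity S P h σ2 y := by
  have := hS.card_pos
  exact Finset.sum_pos (fun x _ => mul_pos (by positivity) (channelDensity_pos hσ x y)) hS

lemma continuous_outputDensity : Continuous (outputDensity S P h σ2) :=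
  continuous_finsetSum _ fun x _ => continuous_const.mul (continuous_channelDensity x)

lemma integrable_outputDensity (hσ : 0 < σ2) : Integrable (outputDensity S P h σ2) :=
  integrable_finsetSum _ fun x _ => (integrable_channelDensity hσ x).const_mul _

lemma integral_outputDensity (hS : S.Nonempty) (hσ : 0 < σ2) :
    ∫ y, outputDensity S P h σ2 y = 1 := by
  have hc : (S.card : ℝ) ≠ 0 := by exact_mod_cast hS.card_pos.ne'
  unfold outputDensity
  rw [integral_finsetSum _ fun x _ => (integrable_channelDensity hσ x).const_mul _]
  simp [integral_const_mul, integral_channelDensity hσ, hc]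

lemma channelDensity_div_outputDensity_le {x : ℂ} (hx : x ∈ S) (hσ : 0 < σ2) (y : ℂ) :
    channelDensity P h σ2 x y / outputDensity S P h σ2 y ≤ S.card := by
  have hS : S.Nonempty := ⟨x, hx⟩
  have hc : (0 : ℝ) < S.card := by exact_mod_cast hS.card_pos
  rw [div_le_iff₀ (outputDensity_pos hS hσ y)]
  have := Finset.single_le_sum (f := fun x => 1 / (S.card : ℝ) * channelDensity P h σ2 x y)
    (fun x _ => mul_nonneg (by positivity) (channelDensity_pos hσ x y).le) hx
  calc channelDensity P h σ2 x y
      = S.card * (1 / (S.card : ℝ) * channelDensity P h σ2 x y) := by field_simp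
    _ ≤ _ := by gcongr; exact this

lemma channelDensity_sub_outputDensity_le (hS : S.Nonempty) (hσ : 0 < σ2) (x y : ℂ) :
    (channelDensity P h σ2 x y - outputDensity S P h σ2 y) / Real.log 2 ≤
      channelDensity P h σ2 x y *
        Real.logb 2 (channelDensity P h σ2 x y / outputDensity S P h σ2 y) := by
  have hp := channelDensity_pos (P := P) (h := h) hσ x y
  have hq := outputDensity_pos (P := P) (h := h) hS hσ y
  have h2 : 0 < Real.log 2 := Real.log_pos (by norm_num)
  have := Real.one_sub_inv_le_log_of_pos (div_pos hp hq)
  rw [Real.logb, ← mul_div_assoc]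
  gcongr
  calc _ = channelDensity P h σ2 x y *
        (1 - (channelDensity P h σ2 x y / outputDensity S P h σ2 y)⁻¹) := by
        field_simp
    _ ≤ _ := by gcongr

lemma integrable_channelDensity_mul_logb {x : ℂ} (hx : x ∈ S) (hσ : 0 < σ2) :
    Integrable fun y => channelDensity P h σ2 x y *
      Real.logb 2 (channelDensity P h σ2 x y / outputDensity S P h σ2 y) := by
  have hS : S.Nonempty := ⟨x, hx⟩
  have h2 : 0 < Real.log 2 := Real.log_pos (by norm_num)
  have hc : (1 : ℝ) ≤ S.card := by exact_mod_cast hS.card_pos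
  have hlog : 0 ≤ Real.logb 2 (S.card : ℝ) := Real.logb_nonneg (by norm_num) hc
  -- The integrand lies between `(p - q) / log 2` and `p * log₂ |S|`.
  refine Integrable.mono' (g := fun y => channelDensity P h σ2 x y * Real.logb 2 (S.card : ℝ) +
    (channelDensity P h σ2 x y + outputDensity S P h σ2 y) / Real.log 2)
    (((integrable_channelDensity hσ x).mul_const _).add
      (((integrable_channelDensity hσ x).add (integrable_outputDensity hσ)).div_const _)) ?_ ?_
  · refine Measurable.aestronglyMeasurable ?_
    have hp := (continuous_channelDensity (P := P) (h := h) (σ2 := σ2) x).measurable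
    have hq := (continuous_outputDensity (S := S) (P := P) (h := h) (σ2 := σ2)).measurable
    exact hp.mul ((Real.measurable_log.comp (hp.div hq)).div_const _)
  · refine Eventually.of_forall fun y => ?_
    have hp := channelDensity_pos (P := P) (h := h) hσ x y
    have hq := outputDensity_pos (P := P) (h := h) hS hσ y
    have hlow := channelDensity_sub_outputDensity_le (P := P) (h := h) hS hσ x y
    have hup : channelDensity P h σ2 x y *
        Real.logb 2 (channelDensity P h σ2 x y / outputDensity S P h σ2 y) ≤
        channelDensity P h σ2 x y * Real.logb 2 (S.card : ℝ) := by
      gcongr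
      · norm_num
      · exact channelDensity_div_outputDensity_le hx hσ y
    have e1 : 0 ≤ channelDensity P h σ2 x y / Real.log 2 := by positivity
    have e2 : 0 ≤ outputDensity S P h σ2 y / Real.log 2 := by positivity
    have e3 : 0 ≤ channelDensity P h σ2 x y * Real.logb 2 (S.card : ℝ) := by positivity
    rw [sub_div] at hlow
    rw [Real.norm_eq_abs, abs_le, add_div]
    constructor <;> linarith

/-! ### Two lower bounds on the mutual information -/

lemma mutualInfo_eq (S : Finset ℂ) (P : ℝ) (h : ℂ) (σ2 : ℝ) :
    mutualInfo S P h σ2 = ∑ x ∈ S, 1 / (S.card : ℝ) * ∫ y : ℂ, channelDensity P h σ2 x y *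
      Real.logb 2 (channelDensity P h σ2 x y / outputDensity S P h σ2 y) := rfl

lemma le_mutualInfo_of_forall_le (hS : S.Nonempty) {b : ℝ}
    (hb : ∀ x ∈ S, b ≤ ∫ y : ℂ, channelDensity P h σ2 x y *
      Real.logb 2 (channelDensity P h σ2 x y / outputDensity S P h σ2 y)) :
    b ≤ mutualInfo S P h σ2 := by
  have hc : (0 : ℝ) < S.card := by exact_mod_cast hS.card_pos
  calc b = ∑ _x ∈ S, 1 / (S.card : ℝ) * b := by
        rw [Finset.sum_const, nsmul_eq_mul]; field_simp
    _ ≤ _ := by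
        rw [mutualInfo_eq]
        exact Finset.sum_le_sum fun x hx => by gcongr; exact hb x hx

lemma mutualInfo_nonneg (S : Finset ℂ) (P : ℝ) (h : ℂ) (hσ : 0 < σ2) :
    0 ≤ mutualInfo S P h σ2 := by
  rcases S.eq_empty_or_nonempty with rfl | hS
  · simp [mutualInfo]
  refine le_mutualInfo_of_forall_le hS fun x hx => ?_
  have hi := ((integrable_channelDensity (P := P) (h := h) hσ x).sub
    (integrable_outputDensity (S := S) (P := P) (h := h) hσ)).div_const (Real.log 2)
  have := integral_mono hi (integrable_channelDensity_mul_logb hx hσ)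
    (channelDensity_sub_outputDensity_le hS hσ x)
  refine le_trans (le_of_eq ?_) this
  simp only [Pi.sub_apply]
  rw [integral_div, integral_sub (integrable_channelDensity hσ x) (integrable_outputDensity hσ),
    integral_channelDensity hσ, integral_outputDensity hS hσ]
  simp

/-- A bound `M` on the output density bounds the output entropy from below by `-log₂ M`, and the
noise has entropy `log₂ (π σ²) + O(1)`. -/
lemma le_mutualInfo_of_outputDensity_le (hS : S.Nonempty) (hσ : 0 < σ2) {M : ℝ}
    (hM : ∀ y, outputDensity S P h σ2 y ≤ M) :
    -Real.logb 2 (Real.pi * σ2 * M) - 4 / Real.log 2 ≤ mutualInfo S P h σ2 := by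
  have h2 : 0 < Real.log 2 := Real.log_pos (by norm_num)
  have hM0 : 0 < M := (outputDensity_pos hS hσ 0).trans_le (hM 0)
  refine le_mutualInfo_of_forall_le hS fun x hx => ?_
  set a : ℂ := (√P : ℂ) * h * x with ha
  have hσ' : 0 < 2 * σ2 := by positivity
  have i1 := (integrable_channelDensity (P := P) (h := h) hσ x).mul_const
    (-Real.logb 2 (Real.pi * σ2 * M))
  have i2 := (integrable_exp_neg_norm_sub_sq_div a hσ').const_mul
    (2 / (Real.pi * σ2) / Real.log 2)
  refine le_trans (le_of_eq ?_)
    (integral_mono (i1.sub i2) (integrable_channelDensity_mul_logb hx hσ) fun y => ?_)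
  · simp only [Pi.sub_apply]
    rw [integral_sub i1 i2, integral_mul_const, integral_channelDensity hσ, integral_const_mul,
      integral_exp_neg_norm_sub_sq_div a hσ']
    field_simp
    ring
  · have hp := channelDensity_pos (P := P) (h := h) hσ x y
    have hq := outputDensity_pos (P := P) (h := h) hS hσ y
    set t : ℝ := ‖y - a‖ ^ 2 / σ2 with ht
    have ht0 : 0 ≤ t := by positivity
    have hpt : channelDensity P h σ2 x y = 1 / (Real.pi * σ2) * Real.exp (-t) := rfl
    have hhalf : ‖y - a‖ ^ 2 / (2 * σ2) = t / 2 := by rw [ht]; field_simp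
    -- `t e^{-t} ≤ 2 e^{-t/2}` replaces the second moment of the noise by a Gaussian integral.
    have hte : t * Real.exp (-t) ≤ 2 * Real.exp (-(t / 2)) := by
      have e1 : t ≤ 2 * Real.exp (t / 2) := by linarith [Real.add_one_le_exp (t / 2)]
      calc t * Real.exp (-t) ≤ 2 * Real.exp (t / 2) * Real.exp (-t) := by gcongr
        _ = 2 * Real.exp (-(t / 2)) := by
          rw [mul_assoc, ← Real.exp_add]; congr 2; ring
    have hlog : Real.log (channelDensity P h σ2 x y / M) =
        -Real.log (Real.pi * σ2 * M) - t := by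
      have : channelDensity P h σ2 x y / M = (Real.pi * σ2 * M)⁻¹ * Real.exp (-t) := by
        rw [hpt]; field_simp
      rw [this, Real.log_mul (by positivity) (by positivity), Real.log_inv, Real.log_exp]
      ring
    calc _ = channelDensity P h σ2 x y * (-Real.logb 2 (Real.pi * σ2 * M)) -
          1 / (Real.pi * σ2) * (2 * Real.exp (-(t / 2))) / Real.log 2 := by
          simp only [Pi.sub_apply, hhalf]; ring
      _ ≤ channelDensity P h σ2 x y * (-Real.logb 2 (Real.pi * σ2 * M)) -
          1 / (Real.pi * σ2) * (t * Real.exp (-t)) / Real.log 2 := by gcongr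
      _ = channelDensity P h σ2 x y * Real.logb 2 (channelDensity P h σ2 x y / M) := by
          rw [Real.logb, Real.logb, hlog, hpt]; ring
      _ ≤ _ := by
          gcongr
          · norm_num
          · exact hM y

end Channel

/-! ### Packing bound on the output density -/

/-- Sum of a Gaussian over a separated set: up to the factor `exp (ρ² / t)`, each term is at
most the average of a Gaussian of twice the variance over the ball of radius `ρ` around its point,
and these balls are disjoint. -/
lemma sum_exp_neg_norm_sub_sq_le {ι : Type*} (S : Finset ι) (f : ι → ℂ) {ρ t : ℝ} (hρ : 0 < ρ)
    (ht : 0 < t) (hsep : ∀ i ∈ S, ∀ j ∈ S, i ≠ j → 2 * ρ ≤ dist (f i) (f j)) (y : ℂ) :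
    ∑ i ∈ S, Real.exp (-(‖y - f i‖ ^ 2 / t)) ≤ 2 * Real.exp (ρ ^ 2 / t) * (t / ρ ^ 2) := by
  have ht' : 0 < 2 * t := by positivity
  set g : ℂ → ℝ := fun z => Real.exp (-(‖z - y‖ ^ 2 / (2 * t))) with hg
  have hgi : Integrable g := integrable_exp_neg_norm_sub_sq_div y ht'
  have hvol (i : ι) : volume.real (Metric.ball (f i) ρ) = Real.pi * ρ ^ 2 := by
    rw [Measure.real, Complex.volume_ball, ENNReal.toReal_mul, ENNReal.toReal_pow,
      ENNReal.toReal_ofReal hρ.le]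
    simp [mul_comm]
  have hball (i : ι) : Real.pi * ρ ^ 2 * Real.exp (-(‖y - f i‖ ^ 2 / t)) ≤
      Real.exp (ρ ^ 2 / t) * ∫ z in Metric.ball (f i) ρ, g z := by
    rw [← hvol i, ← smul_eq_mul, ← setIntegral_const, ← integral_const_mul]
    refine setIntegral_mono_on (integrableOn_const measure_ball_lt_top.ne)
      (hgi.const_mul _).integrableOn measurableSet_ball fun z hz => ?_
    rw [hg, ← Real.exp_add]
    gcongr
    rw [Metric.mem_ball, dist_eq_norm] at hz
    have h1 : ‖z - y‖ ≤ ‖z - f i‖ + ‖y - f i‖ := by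
      rw [norm_sub_rev y]
      exact norm_sub_le_norm_sub_add_norm_sub z (f i) y
    have h2 : ‖z - y‖ ^ 2 ≤ 2 * ρ ^ 2 + 2 * ‖y - f i‖ ^ 2 := by
      nlinarith [norm_nonneg (z - y), norm_nonneg (z - f i), norm_nonneg (y - f i),
        sq_nonneg (‖z - f i‖ - ‖y - f i‖)]
    calc _ = (2 * ρ ^ 2 - (2 * ρ ^ 2 + 2 * ‖y - f i‖ ^ 2)) / (2 * t) := by field_simp; ring
      _ ≤ (2 * ρ ^ 2 - ‖z - y‖ ^ 2) / (2 * t) := by gcongr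
      _ = _ := by field_simp; ring
  have hdisj : (S : Set ι).Pairwise (Function.onFun Disjoint fun i => Metric.ball (f i) ρ) := by
    intro i hi j hj hij
    exact Metric.ball_disjoint_ball (by linarith [hsep i hi j hj hij])
  have hsum : ∑ i ∈ S, ∫ z in Metric.ball (f i) ρ, g z ≤ Real.pi * (2 * t) := by
    rw [← integral_biUnion_finset S (fun i _ => measurableSet_ball) hdisj
      (fun i _ => hgi.integrableOn), ← integral_exp_neg_norm_sub_sq_div y ht']
    exact setIntegral_le_integral hgi (Eventually.of_forall fun z => (Real.exp_pos _).le)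
  have key : Real.pi * ρ ^ 2 * ∑ i ∈ S, Real.exp (-(‖y - f i‖ ^ 2 / t)) ≤
      Real.exp (ρ ^ 2 / t) * (Real.pi * (2 * t)) := by
    rw [Finset.mul_sum]
    refine (Finset.sum_le_sum fun i _ => hball i).trans ?_
    rw [← Finset.mul_sum]
    gcongr
  have hπρ : 0 < Real.pi * ρ ^ 2 := by positivity
  rw [mul_comm, ← le_div_iff₀ hπρ] at key
  refine key.trans (le_of_eq ?_)
  field_simp

/-- The mutual information over a constellation with minimum distance at least `d` is, up to a
constant, at least `log₂ (|S| d² SNR)`, provided that `d² SNR` stays bounded. -/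
lemma le_mutualInfo_of_separated {S : Finset ℂ} (hS : S.Nonempty) {P : ℝ} {h : ℂ} {σ2 d : ℝ}
    (hP : 0 < P) (hh : h ≠ 0) (hσ : 0 < σ2) (hd : 0 < d)
    (hsep : ∀ x ∈ S, ∀ x' ∈ S, x ≠ x' → d ≤ dist x x') :
    Real.logb 2 (S.card * d ^ 2 * snr P h σ2) - 3 -
      (d ^ 2 * snr P h σ2 / 4 + 4) / Real.log 2 ≤ mutualInfo S P h σ2 := by
  have hc : (0 : ℝ) < S.card := by exact_mod_cast hS.card_pos
  have hn : 0 < ‖h‖ := norm_pos_iff.2 hh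
  have hs : 0 < snr P h σ2 := by unfold snr; positivity
  have hsP : 0 < √P := Real.sqrt_pos.2 hP
  set ρ : ℝ := √P * ‖h‖ * d / 2 with hρ
  have hρ0 : 0 < ρ := by positivity
  have hρσ : ρ ^ 2 / σ2 = d ^ 2 * snr P h σ2 / 4 := by
    rw [hρ, snr, div_pow, mul_pow, mul_pow, Real.sq_sqrt hP.le]
    ring
  set M : ℝ := 1 / S.card * (1 / (Real.pi * σ2)) *
    (2 * Real.exp (ρ ^ 2 / σ2) * (σ2 / ρ ^ 2)) with hMdef
  have hM : ∀ y, outputDensity S P h σ2 y ≤ M := by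
    intro y
    have := sum_exp_neg_norm_sub_sq_le S (fun x => (√P : ℂ) * h * x) hρ0 hσ
      (fun x hx x' hx' hne => ?_) y
    · rw [hMdef]
      unfold outputDensity channelDensity
      rw [← Finset.mul_sum, ← Finset.mul_sum, mul_assoc]
      gcongr
    · rw [dist_eq_norm, ← mul_sub, norm_mul, norm_mul, Complex.norm_real,
        Real.norm_of_nonneg hsP.le, ← dist_eq_norm]
      have := hsep x hx x' hx' hne
      calc 2 * ρ = √P * ‖h‖ * d := by rw [hρ]; ring
        _ ≤ _ := by gcongr
  refine le_trans (le_of_eq ?_) (le_mutualInfo_of_outputDensity_le hS hσ hM)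
  have hMeq : Real.pi * σ2 * M =
      2 ^ 3 * Real.exp (d ^ 2 * snr P h σ2 / 4) / (S.card * d ^ 2 * snr P h σ2) := by
    have : σ2 / ρ ^ 2 = 4 / (d ^ 2 * snr P h σ2) := by
      rw [← inv_div, hρσ, inv_div]
    rw [hMdef, this, hρσ]
    field_simp
    norm_num
  have hlog (t : ℝ) : Real.logb 2 (2 ^ 3 * Real.exp t) = 3 + t / Real.log 2 := by
    rw [Real.logb_mul (by norm_num) (Real.exp_ne_zero t), Real.logb_pow,
      Real.logb_self_eq_one (by norm_num), Real.logb, Real.log_exp]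
    norm_num
  rw [hMeq, Real.logb_div (by positivity) (by positivity), hlog]
  ring

end

/-! ### Distances in a constellation -/

namespace APSK

/-- `(k, n)` is the label of a point of the constellation. -/
def IsLabel (A : APSK) (k n : ℕ) : Prop := 1 ≤ k ∧ k ≤ A.K ∧ n < A.N k

/-- Points with different labels are at distance at least `d`. -/
def Separated (A : APSK) (d : ℝ) : Prop :=
  ∀ ⦃k n k' n' : ℕ⦄, A.IsLabel k n → A.IsLabel k' n' → (k, n) ≠ (k', n') →
    d ≤ dist (A.point k n) (A.point k' n')

variable {A : APSK}

lemma norm_point (A : APSK) (k n : ℕ) : ‖A.point k n‖ = |A.r k| := by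
  rw [point, norm_mul, mul_comm Complex.I, Complex.norm_exp_ofReal_mul_I, Complex.norm_real,
    Real.norm_eq_abs, mul_one]

lemma abs_sub_le_dist_point {k k' : ℕ} (hk : 0 ≤ A.r k) (hk' : 0 ≤ A.r k') (n n' : ℕ) :
    |A.r k - A.r k'| ≤ dist (A.point k n) (A.point k' n') := by
  have := abs_norm_sub_norm_le (A.point k n) (A.point k' n')
  rwa [norm_point, norm_point, abs_of_nonneg hk, abs_of_nonneg hk', ← dist_eq_norm] at this

end APSK

lemma two_div_le_sin_pi_mul_div {j N : ℕ} (hj : 0 < j) (hjN : j < N) :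
    2 / (N : ℝ) ≤ Real.sin (Real.pi * j / N) := by
  have hN : (0 : ℝ) < N := by exact_mod_cast hj.trans hjN
  have hπ := Real.pi_pos
  -- The bound `2 x / π ≤ sin x` applies on `[0, π / 2]`, so `j` is reflected to `N - j` beyond it.
  have aux : ∀ i : ℕ, 0 < i → 2 * i ≤ N → 2 / (N : ℝ) ≤ Real.sin (Real.pi * i / N) := by
    intro i hi hiN
    have hi' : (1 : ℝ) ≤ i := by exact_mod_cast hi
    have hiN' : 2 * (i : ℝ) ≤ N := by exact_mod_cast hiN
    have := Real.mul_le_sin (x := Real.pi * i / N) (by positivity) (by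
      rw [div_le_div_iff₀ hN (by norm_num)]; nlinarith)
    refine le_trans ?_ this
    calc 2 / (N : ℝ) = 2 / N * 1 := by ring
      _ ≤ 2 / N * i := by gcongr
      _ = _ := by field_simp
  rcases le_total (2 * j) N with h | h
  · exact aux j hj h
  · have := aux (N - j) (by omega) (by omega)
    rw [Nat.cast_sub hjN.le] at this
    rw [← Real.sin_pi_sub]
    convert this using 2
    field_simp

namespace APSK

variable {A : APSK}

lemma le_dist_point_same_ring {k n n' : ℕ} (hr : 0 ≤ A.r k) (hn : n < A.N k) (hn' : n' < A.N k)
    (hne : n ≠ n') : 4 * A.r k / A.N k ≤ dist (A.point k n) (A.point k n') := by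
  wlog hlt : n < n' generalizing n n'
  · rw [dist_comm]
    exact this hn' hn hne.symm (by omega)
  have hN : (0 : ℝ) < A.N k := by exact_mod_cast (by omega : 0 < A.N k)
  have hsin := two_div_le_sin_pi_mul_div (j := n' - n) (N := A.N k) (by omega) (by omega)
  have hfac : A.point k n' - A.point k n = A.point k n *
      (Complex.exp (Complex.I * ((2 * Real.pi * (n' - n : ℕ) / A.N k : ℝ) : ℂ)) - 1) := by
    rw [mul_sub, mul_one, point, point, mul_assoc (A.r k : ℂ), ← Complex.exp_add,
      ← mul_add, ← Complex.ofReal_add]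
    congr 5
    rw [Nat.cast_sub hlt.le]
    ring
  have hhalf : 2 * Real.pi * (n' - n : ℕ) / A.N k / 2 = Real.pi * (n' - n : ℕ) / A.N k := by ring
  rw [dist_comm, dist_eq_norm, hfac, norm_mul, norm_point, Complex.norm_exp_I_mul_ofReal_sub_one,
    hhalf, abs_of_nonneg hr, Real.norm_eq_abs]
  calc 4 * A.r k / A.N k = A.r k * (2 * (2 / A.N k)) := by ring
    _ ≤ A.r k * (2 * Real.sin (Real.pi * (n' - n : ℕ) / A.N k)) := by gcongr
    _ ≤ _ := by gcongr; exact le_abs_self _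

lemma dist_point_one_two (h : A.φ 2 - A.φ 1 = 0) : dist (A.point 1 0) (A.point 2 0) =
    |A.r 2 - A.r 1| := by
  have hφ : A.φ 2 = A.φ 1 := by linarith
  rw [dist_comm, dist_eq_norm, point, point, hφ]
  simp only [Nat.cast_zero, mul_zero, zero_div, add_zero]
  rw [← sub_mul, norm_mul, mul_comm Complex.I, Complex.norm_exp_ofReal_mul_I, mul_one,
    ← Complex.ofReal_sub, Complex.norm_real, Real.norm_eq_abs]

/-- Separation of a constellation with rings of radii at least `ε` apart and at most `B` points
per unit of radius. -/
lemma separated_of_le {ε B : ℝ} (hB : 0 < B)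
    (hr : ∀ k, 1 ≤ k → k ≤ A.K → 0 ≤ A.r k)
    (hstep : ∀ k, 1 ≤ k → k < A.K → ε ≤ A.r (k + 1) - A.r k) (hε : 0 < ε)
    (hN : ∀ k, 1 ≤ k → k ≤ A.K → (A.N k : ℝ) ≤ B * A.r k) :
    A.Separated (min ε (4 / B)) := by
  have hmono : ∀ k k', 1 ≤ k → k < k' → k' ≤ A.K → ε ≤ A.r k' - A.r k := by
    intro k k' hk hkk'
    induction k', hkk' using Nat.le_induction with
    | base => intro h; exact hstep k hk h
    | succ j hj ih =>
      intro h
      have h1 := ih (by omega)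
      have h2 := hstep j (by omega) h
      linarith
  intro k n k' n' hl hl' hne
  obtain ⟨hk1, hkK, hn⟩ := hl
  obtain ⟨hk1', hkK', hn'⟩ := hl'
  rcases lt_trichotomy k k' with hlt | rfl | hlt
  · refine (min_le_left _ _).trans (le_trans ?_ (abs_sub_le_dist_point (hr k hk1 hkK)
      (hr k' hk1' hkK') n n'))
    rw [abs_sub_comm]
    exact (hmono k k' hk1 hlt hkK').trans (le_abs_self _)
  · refine (min_le_right _ _).trans (le_trans ?_ (le_dist_point_same_ring (hr k hk1 hkK) hn hn'
      (by rintro rfl; exact hne rfl)))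
    have hNpos : (0 : ℝ) < A.N k := by exact_mod_cast (by omega : 0 < A.N k)
    rw [div_le_div_iff₀ hB hNpos]
    linarith [hN k hk1 hkK]
  · refine (min_le_left _ _).trans (le_trans ?_ (abs_sub_le_dist_point (hr k hk1 hkK)
      (hr k' hk1' hkK') n n'))
    exact (hmono k' k hk1' hlt hkK).trans (le_abs_self _)

lemma mem_points {x : ℂ} : x ∈ A.points ↔ ∃ k n, A.IsLabel k n ∧ A.point k n = x := by
  simp only [points, Finset.mem_biUnion, Finset.mem_Icc, Finset.mem_image, Finset.mem_range,
    IsLabel]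
  constructor
  · rintro ⟨k, ⟨h1, h2⟩, n, h3, h4⟩
    exact ⟨k, n, ⟨h1, h2, h3⟩, h4⟩
  · rintro ⟨k, n, ⟨h1, h2, h3⟩, h4⟩
    exact ⟨k, ⟨h1, h2⟩, n, h3, h4⟩

lemma Separated.le_dist {d : ℝ} (hs : A.Separated d) :
    ∀ x ∈ A.points, ∀ x' ∈ A.points, x ≠ x' → d ≤ dist x x' := by
  intro x hx x' hx' hne
  obtain ⟨k, n, hl, rfl⟩ := mem_points.1 hx
  obtain ⟨k', n', hl', rfl⟩ := mem_points.1 hx'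
  refine hs hl hl' ?_
  rintro ⟨⟩
  exact hne rfl

/-- In a separated constellation distinct labels give distinct points, so sums over the
constellation are sums over the labels. -/
lemma Separated.sum_points {d : ℝ} (hd : 0 < d) (hs : A.Separated d) (f : ℂ → ℝ) :
    ∑ x ∈ A.points, f x =
      ∑ k ∈ Finset.Icc 1 A.K, ∑ n ∈ Finset.range (A.N k), f (A.point k n) := by
  have hinj : ∀ ⦃k n k' n'⦄, A.IsLabel k n → A.IsLabel k' n' →
      A.point k n = A.point k' n' → (k, n) = (k', n') := by
    intro k n k' n' hl hl' he
    by_contra hne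
    have := hs hl hl' hne
    rw [he, dist_self] at this
    linarith
  rw [points, Finset.sum_biUnion]
  · refine Finset.sum_congr rfl fun k hk => ?_
    rw [Finset.mem_Icc] at hk
    refine Finset.sum_image fun n hn n' hn' he => ?_
    have := hinj ⟨hk.1, hk.2, Finset.mem_range.1 hn⟩ ⟨hk.1, hk.2, Finset.mem_range.1 hn'⟩ he
    exact (Prod.ext_iff.1 this).2
  · intro k hk k' hk' hne
    rw [Finset.mem_coe, Finset.mem_Icc] at hk hk'
    refine Finset.disjoint_left.2 fun x hx hx' => hne ?_
    simp only [Finset.mem_image, Finset.mem_range] at hx hx'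
    obtain ⟨n, hn, rfl⟩ := hx
    obtain ⟨n', hn', he⟩ := hx'
    exact (Prod.ext_iff.1 (hinj ⟨hk.1, hk.2, hn⟩ ⟨hk'.1, hk'.2, hn'⟩ he.symm)).1

lemma Separated.card_points {d : ℝ} (hd : 0 < d) (hs : A.Separated d) {m : ℕ}
    (hA : A.IsAPSK m) : (A.points.card : ℝ) = 2 ^ m := by
  have := hs.sum_points hd fun _ => 1
  simp only [Finset.sum_const, Finset.card_range, nsmul_eq_mul, mul_one] at this
  rw [this]
  exact_mod_cast hA.sum_N

lemma Separated.energy_eq {d : ℝ} (hd : 0 < d) (hs : A.Separated d) (m : ℕ) :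
    A.energy m = (∑ k ∈ Finset.Icc 1 A.K, A.N k * A.r k ^ 2) / 2 ^ m := by
  rw [energy, hs.sum_points hd]
  simp only [norm_point, sq_abs, Finset.sum_const, Finset.card_range, nsmul_eq_mul]

lemma dist_normalized_point (A : APSK) (m k n k' n' : ℕ) :
    dist ((A.normalized m).point k n) ((A.normalized m).point k' n') =
      dist (A.point k n) (A.point k' n') / √(A.energy m) := by
  have h (k n : ℕ) : (A.normalized m).point k n = A.point k n / (√(A.energy m) : ℂ) := by
    simp only [point, normalized]
    push_cast
    ring
  rw [h, h, dist_eq_norm, dist_eq_norm, ← sub_div, norm_div, Complex.norm_real,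
    Real.norm_of_nonneg (Real.sqrt_nonneg _)]

lemma Separated.normalized {d E : ℝ} (hs : A.Separated d) {m : ℕ}
    (h0 : 0 < A.energy m) (hE : A.energy m ≤ E) : (A.normalized m).Separated (d / √E) := by
  intro k n k' n' hl hl' hne
  rw [dist_normalized_point]
  exact div_le_div₀ dist_nonneg (hs hl hl' hne) (Real.sqrt_pos.2 h0) (Real.sqrt_le_sqrt hE)

lemma IsAPSK.normalized {m : ℕ} (hA : A.IsAPSK m) (h0 : 0 < A.energy m) :
    (A.normalized m).IsAPSK m :=
  ⟨hA.one_le_K, hA.N_pos, fun k h1 h2 => div_pos (hA.r_pos k h1 h2) (Real.sqrt_pos.2 h0),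
    hA.sum_N⟩

end APSK

/-! ### The scaling laws -/

lemma sq_div_two_le_sum_Icc (n : ℕ) : (n : ℝ) ^ 2 / 2 ≤ ∑ k ∈ Finset.Icc 1 n, (k : ℝ) := by
  induction n with
  | zero => simp
  | succ n ih =>
    rw [Finset.sum_Icc_succ_top (by omega)]
    push_cast
    nlinarith

lemma pow_four_div_four_le_sum_Icc (n : ℕ) :
    (n : ℝ) ^ 4 / 4 ≤ ∑ k ∈ Finset.Icc 1 n, (k : ℝ) ^ 3 := by
  induction n with
  | zero => simp
  | succ n ih =>
    rw [Finset.sum_Icc_succ_top (by omega)]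
    push_cast
    have : (0 : ℝ) ≤ n := n.cast_nonneg
    nlinarith [sq_nonneg (n : ℝ)]

namespace APSK

variable {A : ℕ → APSK}

/-- The number of rings is comparable to `√(2^m)`, and in particular at least `2`. -/
lemma IsCommOptimalFamily.exists_rings_bounds (hA : IsCommOptimalFamily A) :
    ∃ c C : ℝ, 0 < c ∧ 0 < C ∧ ∀ᶠ m : ℕ in atTop, 2 ≤ (A m).K ∧
      c * √((2 : ℝ) ^ m) ≤ (A m).K ∧ ((A m).K : ℝ) ≤ C * √((2 : ℝ) ^ m) := by
  obtain ⟨C, hC, h1⟩ := hA.rings.1.exists_pos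
  obtain ⟨c, hc, h2⟩ := hA.rings.2.exists_pos
  refine ⟨c⁻¹, C, inv_pos.2 hc, hC, ?_⟩
  have htend : Tendsto (fun m : ℕ => √((2 : ℝ) ^ m)) atTop atTop :=
    Real.tendsto_sqrt_atTop.comp (tendsto_pow_atTop_atTop_of_one_lt (by norm_num))
  filter_upwards [h1.bound, h2.bound, htend.eventually_ge_atTop (2 * c)] with m h1 h2 h3
  simp only [Real.norm_eq_abs, abs_of_nonneg (Real.sqrt_nonneg _), Nat.abs_cast] at h1 h2
  have h4 : c⁻¹ * √((2 : ℝ) ^ m) ≤ (A m).K := by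
    rw [inv_mul_le_iff₀ hc]; exact h2
  refine ⟨?_, h4, h1⟩
  have : (2 : ℝ) ≤ (A m).K := by
    refine le_trans ?_ h4
    rw [le_inv_mul_iff₀ hc]
    linarith
  exact_mod_cast this

/-- The ring sizes grow at most linearly: the multiplier `a_m` is bounded since the
`Θ(√(2^m))` rings hold `2^m` points in total. -/
lemma IsCommOptimalFamily.exists_ring_size_le (hA : IsCommOptimalFamily A) :
    ∃ B : ℝ, 0 < B ∧ ∀ᶠ m : ℕ in atTop, ∀ k, 1 ≤ k → k ≤ (A m).K →
      ((A m).N k : ℝ) ≤ B * k := by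
  obtain ⟨c, C, hc, -, hK⟩ := hA.exists_rings_bounds
  obtain ⟨D, hD, hlast⟩ := hA.last_ring.1.exists_pos
  obtain ⟨a, ha⟩ := hA.ring_size
  refine ⟨max D (8 / c ^ 2), by positivity, ?_⟩
  filter_upwards [hK, hlast.bound, eventually_ge_atTop 2] with m ⟨hK2, hKc, _⟩ hl hm k hk1 hkK
  simp only [Real.norm_eq_abs, Nat.abs_cast] at hl
  rcases hkK.eq_or_lt with rfl | hlt
  · exact hl.trans (by gcongr; exact le_max_left _ _)
  rw [ha m hm k hk1 hlt]
  push_cast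
  gcongr
  refine le_trans ?_ (le_max_right _ _)
  rw [le_div_iff₀ (by positivity)]
  set K := (A m).K
  have hsq : √((2 : ℝ) ^ m) ^ 2 = 2 ^ m := Real.sq_sqrt (by positivity)
  have hK2' : (2 : ℝ) ≤ K := by exact_mod_cast hK2
  have hcK : c ^ 2 * 2 ^ m ≤ (K : ℝ) ^ 2 := by
    rw [← hsq, ← mul_pow]
    gcongr
  have hsum : (a m : ℝ) * ∑ k ∈ Finset.Icc 1 (K - 1), (k : ℝ) ≤ 2 ^ m := by
    have h1 : ∑ k ∈ Finset.Icc 1 (K - 1), (A m).N k ≤ 2 ^ m := by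
      rw [← (hA.isAPSK m hm).sum_N]
      exact Finset.sum_le_sum_of_subset (Finset.Icc_subset_Icc le_rfl (Nat.sub_le _ _))
    have h2 : ∑ k ∈ Finset.Icc 1 (K - 1), (A m).N k = a m * ∑ k ∈ Finset.Icc 1 (K - 1), k := by
      rw [Finset.mul_sum]
      refine Finset.sum_congr rfl fun k hk => ?_
      rw [Finset.mem_Icc] at hk
      exact ha m hm k hk.1 (show k < K by omega)
    rw [h2, ← Nat.cast_le (α := ℝ)] at h1
    push_cast at h1
    exact h1
  have hsq2 := sq_div_two_le_sum_Icc (K - 1)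
  rw [Nat.cast_sub (by omega), Nat.cast_one] at hsq2
  have h8 : (K : ℝ) ^ 2 / 8 ≤ ∑ k ∈ Finset.Icc 1 (K - 1), (k : ℝ) := by
    refine le_trans ?_ hsq2
    nlinarith
  have ha0 : (0 : ℝ) ≤ a m := (a m).cast_nonneg
  have h2m : (0 : ℝ) < 2 ^ m := by positivity
  refine le_of_mul_le_mul_right ?_ h2m
  calc (a m : ℝ) * c ^ 2 * 2 ^ m = 8 * (a m * (c ^ 2 * 2 ^ m / 8)) := by ring
    _ ≤ 8 * (a m * ((K : ℝ) ^ 2 / 8)) := by gcongr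
    _ ≤ 8 * (a m * ∑ k ∈ Finset.Icc 1 (K - 1), (k : ℝ)) := by gcongr
    _ ≤ 8 * 2 ^ m := by gcongr

lemma IsCommOptimalFamily.exists_separated (hA : IsCommOptimalFamily A) :
    ∃ c : ℝ, 0 < c ∧ ∀ᶠ m : ℕ in atTop, (A m).Separated (c / √((2 : ℝ) ^ m)) := by
  obtain ⟨B, hB, hN⟩ := hA.exists_ring_size_le
  obtain ⟨c, C, hc, hr⟩ := hA.radius
  obtain ⟨c', C', hc', hstep⟩ := hA.radius_step
  refine ⟨min c' (4 * c / B), by positivity, ?_⟩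
  filter_upwards [hN, hr, hstep, eventually_ge_atTop 2] with m hN hr hstep hm
  set s := √((2 : ℝ) ^ m) with hs
  have hs0 : 0 < s := by positivity
  have := separated_of_le (A := A m) (ε := c' / s) (B := B * s / c) (by positivity)
    (fun k h1 h2 => ((hA.isAPSK m hm).r_pos k h1 h2).le)
    (fun k h1 h2 => by
      have := (hstep k h1 h2).1
      rwa [mul_one_div] at this) (by positivity)
    (fun k h1 h2 => by
      refine (hN k h1 h2).trans ?_
      calc B * k = B * s / c * (c * (k / s)) := by field_simp
        _ ≤ _ := by gcongr; exact (hr k h1 h2).1)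
  convert this using 1
  rw [← min_div_div_right hs0.le]
  congr 1
  field_simp

/-- The average energy is bounded, and bounded away from zero: the rings reach out to a radius of
order `1`, and they hold at least `k` points each. -/
lemma IsCommOptimalFamily.exists_energy_bounds (hA : IsCommOptimalFamily A) :
    ∃ e E : ℝ, 0 < e ∧ 0 < E ∧ ∀ᶠ m : ℕ in atTop, e ≤ (A m).energy m ∧ (A m).energy m ≤ E := by
  obtain ⟨d, hd, hsep⟩ := hA.exists_separated
  obtain ⟨κ, κ', hκ, hκ', hK⟩ := hA.exists_rings_bounds
  obtain ⟨c, C, hc, hr⟩ := hA.radius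
  obtain ⟨a, ha⟩ := hA.ring_size
  refine ⟨c ^ 2 * κ ^ 4 / 64, (|C| * κ') ^ 2 + 1, by positivity, by positivity, ?_⟩
  filter_upwards [hsep, hK, hr, eventually_ge_atTop 2] with m hsep ⟨hK2, hKlow, hKup⟩ hr hm
  have hAm := hA.isAPSK m hm
  rw [hsep.energy_eq (by positivity)]
  set s := √((2 : ℝ) ^ m) with hs
  have hs0 : 0 < s := by positivity
  have hsq : s ^ 2 = 2 ^ m := Real.sq_sqrt (by positivity)
  set K := (A m).K with hKdef
  have hK2' : (2 : ℝ) ≤ K := by exact_mod_cast hK2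
  rw [le_div_iff₀ (by positivity), div_le_iff₀ (by positivity)]
  constructor
  · have hN (k : ℕ) (h1 : 1 ≤ k) (h2 : k < K) : (k : ℝ) ≤ (A m).N k := by
      have hpos := hAm.N_pos k h1 h2.le
      rw [ha m hm k h1 h2] at hpos ⊢
      exact_mod_cast Nat.le_mul_of_pos_left k (Nat.pos_of_mul_pos_right hpos)
    have hcube := pow_four_div_four_le_sum_Icc (K - 1)
    rw [Nat.cast_sub (by omega), Nat.cast_one] at hcube
    have h64 : (K : ℝ) ^ 4 / 64 ≤ ((K : ℝ) - 1) ^ 4 / 4 := by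
      calc (K : ℝ) ^ 4 / 64 = ((K : ℝ) / 2) ^ 4 / 4 := by ring
        _ ≤ _ := by gcongr; linarith
    calc c ^ 2 * κ ^ 4 / 64 * 2 ^ m = c ^ 2 / s ^ 2 * ((κ * s) ^ 4 / 64) := by
          rw [← hsq]; field_simp
      _ ≤ c ^ 2 / s ^ 2 * (K ^ 4 / 64) := by gcongr
      _ ≤ c ^ 2 / s ^ 2 * ∑ k ∈ Finset.Icc 1 (K - 1), (k : ℝ) ^ 3 := by
          gcongr; exact h64.trans hcube
      _ = ∑ k ∈ Finset.Icc 1 (K - 1), (k : ℝ) * (c * (k / s)) ^ 2 := by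
          rw [Finset.mul_sum]
          exact Finset.sum_congr rfl fun k _ => by ring
      _ ≤ ∑ k ∈ Finset.Icc 1 (K - 1), ((A m).N k : ℝ) * (A m).r k ^ 2 := by
          refine Finset.sum_le_sum fun k hk => ?_
          rw [Finset.mem_Icc] at hk
          have h1 := hN k hk.1 (by omega)
          have h2 := (hr k hk.1 (by omega)).1
          gcongr
      _ ≤ _ := Finset.sum_le_sum_of_subset_of_nonneg
          (Finset.Icc_subset_Icc le_rfl (Nat.sub_le _ _)) fun k _ _ => by positivity
  · calc ∑ k ∈ Finset.Icc 1 K, ((A m).N k : ℝ) * (A m).r k ^ 2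
        ≤ ∑ k ∈ Finset.Icc 1 K, ((A m).N k : ℝ) * (|C| * κ') ^ 2 := by
          refine Finset.sum_le_sum fun k hk => ?_
          rw [Finset.mem_Icc] at hk
          have h0 := hAm.r_pos k hk.1 hk.2
          have h1 := (hr k hk.1 hk.2).2
          have h2 : (k : ℝ) ≤ κ' * s := le_trans (by exact_mod_cast hk.2) hKup
          gcongr
          calc (A m).r k ≤ C * (k / s) := h1
            _ ≤ |C| * (k / s) := by gcongr; exact le_abs_self _
            _ ≤ |C| * (κ' * s / s) := by gcongr
            _ = |C| * κ' := by field_simp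
      _ = (|C| * κ') ^ 2 * 2 ^ m := by
          rw [← Finset.sum_mul, mul_comm]
          congr 1
          exact_mod_cast hAm.sum_N
      _ ≤ _ := by gcongr; linarith

/-- The minimum distance of the normalized constellations is of order `1 / √(2^m)`; the upper bound
comes from the two innermost rings, whose first points have the same argument. -/
lemma IsCommOptimalFamily.exists_normalized_bounds (hA : IsCommOptimalFamily A) :
    ∃ c C : ℝ, 0 < c ∧ ∀ᶠ m : ℕ in atTop, 0 < (A m).energy m ∧
      ((A m).normalized m).Separated (c / √((2 : ℝ) ^ m)) ∧
      ((A m).normalized m).IsLabel 1 0 ∧ ((A m).normalized m).IsLabel 2 0 ∧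
      dist (((A m).normalized m).point 1 0) (((A m).normalized m).point 2 0) ≤
        C / √((2 : ℝ) ^ m) := by
  obtain ⟨d, hd, hsep⟩ := hA.exists_separated
  obtain ⟨κ, κ', hκ, hκ', hK⟩ := hA.exists_rings_bounds
  obtain ⟨e, E, he, hE, hen⟩ := hA.exists_energy_bounds
  obtain ⟨c', C', hc', hstep⟩ := hA.radius_step
  refine ⟨d / √E, C' / √e, by positivity, ?_⟩
  filter_upwards [hsep, hK, hen, hstep, eventually_ge_atTop 2] with m hsep ⟨hK2, _⟩ hen hstep hm
  have hAm := hA.isAPSK m hm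
  have h0 : 0 < (A m).energy m := he.trans_le hen.1
  refine ⟨h0, ?_, ⟨le_rfl, hAm.one_le_K, hAm.N_pos 1 le_rfl hAm.one_le_K⟩,
    ⟨by norm_num, hK2, hAm.N_pos 2 (by norm_num) hK2⟩, ?_⟩
  · rw [div_right_comm]
    exact hsep.normalized h0 hen.2
  · have h1 := hstep 1 le_rfl hK2
    have hpos : 0 ≤ (A m).r 2 - (A m).r 1 := le_trans (by positivity) h1.1
    rw [dist_normalized_point, dist_point_one_two (hA.phase m hm 1 le_rfl hK2), abs_of_nonneg hpos]
    have h2 : (A m).r 2 - (A m).r 1 ≤ C' / √((2 : ℝ) ^ m) := by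
      have := h1.2
      rwa [mul_one_div] at this
    rw [div_right_comm]
    have hs := Real.sqrt_le_sqrt hen.1
    have hse : 0 < √e := Real.sqrt_pos.2 he
    have := hpos.trans h2
    gcongr

end APSK

/-! ### Minimum distance and gap to capacity -/

namespace APSK

lemma Separated.le_minDist {A : APSK} {d : ℝ} (hs : A.Separated d) {k n k' n' : ℕ}
    (hl : A.IsLabel k n) (hl' : A.IsLabel k' n') (hne : (k, n) ≠ (k', n')) : d ≤ A.minDist := by
  refine le_csInf ⟨_, k, n, k', n', hl, hl', hne, rfl⟩ ?_
  rintro x ⟨k, n, k', n', hl, hl', hne, rfl⟩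
  exact hs hl hl' hne

lemma minDist_nonneg (A : APSK) : 0 ≤ A.minDist :=
  Real.sInf_nonneg (by rintro x ⟨k, n, k', n', -, -, -, rfl⟩; exact dist_nonneg)

lemma minDist_le {A : APSK} {k n k' n' : ℕ} (hl : A.IsLabel k n) (hl' : A.IsLabel k' n')
    (hne : (k, n) ≠ (k', n')) : A.minDist ≤ dist (A.point k n) (A.point k' n') :=
  csInf_le ⟨0, by rintro x ⟨k, n, k', n', -, -, -, rfl⟩; exact dist_nonneg⟩
    ⟨k, n, k', n', hl, hl', hne, rfl⟩

variable {A : ℕ → APSK}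

lemma IsCommOptimalFamily.minDist_sq_isTheta (hA : IsCommOptimalFamily A) :
    (fun m => ((A m).normalized m).minDist ^ 2) =Θ[atTop] (fun m : ℕ => ((2 : ℝ) ^ m)⁻¹) := by
  obtain ⟨c, C, hc, hb⟩ := hA.exists_normalized_bounds
  have hsq (m : ℕ) (a : ℝ) : (a / √((2 : ℝ) ^ m)) ^ 2 = a ^ 2 * ((2 : ℝ) ^ m)⁻¹ := by
    rw [div_pow, Real.sq_sqrt (by positivity), div_eq_mul_inv]
  constructor
  · refine IsBigO.of_bound (C ^ 2) ?_
    filter_upwards [hb] with m ⟨_, _, hl, hl', hle⟩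
    rw [Real.norm_of_nonneg (by positivity), Real.norm_of_nonneg (by positivity), ← hsq]
    have := minDist_nonneg ((A m).normalized m)
    have := minDist_le hl hl' (by simp)
    gcongr
    exact this.trans hle
  · refine IsBigO.of_bound (c ^ 2)⁻¹ ?_
    filter_upwards [hb] with m ⟨_, hs, hl, hl', _⟩
    rw [Real.norm_of_nonneg (by positivity), Real.norm_of_nonneg (by positivity),
      le_inv_mul_iff₀ (by positivity), ← hsq]
    have := hs.le_minDist hl hl' (by simp)
    gcongr

/-- A separation of order `1 / √(2^m)` makes `|S| d² SNR` comparable to the SNR, and the assumption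
on `m` keeps `d² SNR` bounded. Below an SNR of `1` nonnegativity of the mutual information is
enough. -/
lemma gap_le_of_separated {A : APSK} {m : ℕ} (hA : A.IsAPSK m) {c κ : ℝ} (hc : 0 < c)
    (hs : A.Separated (c / √((2 : ℝ) ^ m))) {P : ℝ} {h : ℂ} {σ2 : ℝ} (hP : 0 < P) (hh : h ≠ 0)
    (hσ : 0 < σ2) (hm : snr P h σ2 ≤ 2 ^ κ * 2 ^ m) :
    gaussianCapacity (snr P h σ2) - mutualInfo A.points P h σ2 ≤
      4 + |Real.logb 2 (c ^ 2)| + (c ^ 2 * 2 ^ κ / 4 + 4) / Real.log 2 := by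
  have hn : 0 < ‖h‖ := norm_pos_iff.2 hh
  have hsnr : 0 < snr P h σ2 := by unfold snr; positivity
  have h2 : 0 < Real.log 2 := Real.log_pos (by norm_num)
  have hrest : 0 ≤ (c ^ 2 * 2 ^ κ / 4 + 4) / Real.log 2 := by positivity
  unfold gaussianCapacity
  rcases le_total (snr P h σ2) 1 with h1 | h1
  · have hI := mutualInfo_nonneg A.points P h hσ
    have hcap : Real.logb 2 (1 + snr P h σ2) ≤ 1 := by
      rw [Real.logb_le_iff_le_rpow (by norm_num) (by positivity), Real.rpow_one]
      linarith
    have := abs_nonneg (Real.logb 2 (c ^ 2))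
    linarith
  · have hcard := hs.card_points (by positivity) hA
    have hne : A.points.Nonempty := by
      rw [← Finset.card_pos, ← Nat.cast_pos (α := ℝ), hcard]
      positivity
    have hI := le_mutualInfo_of_separated hne hP hh hσ (by positivity) hs.le_dist
    have hdsq : (c / √((2 : ℝ) ^ m)) ^ 2 = c ^ 2 / 2 ^ m := by
      rw [div_pow, Real.sq_sqrt (by positivity)]
    have hprod : (A.points.card : ℝ) * (c / √((2 : ℝ) ^ m)) ^ 2 * snr P h σ2 =
        c ^ 2 * snr P h σ2 := by
      rw [hcard, hdsq]; field_simp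
    have hbdd : (c / √((2 : ℝ) ^ m)) ^ 2 * snr P h σ2 ≤ c ^ 2 * 2 ^ κ := by
      rw [hdsq]
      calc c ^ 2 / 2 ^ m * snr P h σ2 ≤ c ^ 2 / 2 ^ m * (2 ^ κ * 2 ^ m) := by gcongr
        _ = c ^ 2 * 2 ^ κ := by field_simp
    rw [hprod, Real.logb_mul (by positivity) hsnr.ne'] at hI
    have hcap : Real.logb 2 (1 + snr P h σ2) ≤ 1 + Real.logb 2 (snr P h σ2) := by
      calc Real.logb 2 (1 + snr P h σ2) ≤ Real.logb 2 (2 * snr P h σ2) := by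
            gcongr
            · norm_num
            · linarith
        _ = 1 + Real.logb 2 (snr P h σ2) := by
            rw [Real.logb_mul (by norm_num) hsnr.ne', Real.logb_self_eq_one (by norm_num)]
    have hdiv : ((c / √((2 : ℝ) ^ m)) ^ 2 * snr P h σ2 / 4 + 4) / Real.log 2 ≤
        (c ^ 2 * 2 ^ κ / 4 + 4) / Real.log 2 := by gcongr
    have := neg_abs_le (Real.logb 2 (c ^ 2))
    linarith

end APSK

theorem mainTheorem1 (A : ℕ → APSK) (hA : APSK.IsCommOptimalFamily A) :
    (fun m => ((A m).normalized m).minDist ^ 2) =Θ[atTop] (fun m : ℕ => ((2 : ℝ) ^ m)⁻¹) ∧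
    ∀ κ : ℝ, ∃ G : ℝ, ∀ m : ℕ, 2 ≤ m → ∀ (P : ℝ) (h : ℂ) (σ2 : ℝ), 0 < P → h ≠ 0 → 0 < σ2 →
      Real.logb 2 (snr P h σ2) - κ ≤ (m : ℝ) →
      gaussianCapacity (snr P h σ2) - mutualInfo ((A m).normalized m).points P h σ2 ≤ G := by
  refine ⟨hA.minDist_sq_isTheta, fun κ => ?_⟩
  obtain ⟨c, C, hc, hb⟩ := hA.exists_normalized_bounds
  obtain ⟨M, hM⟩ := eventually_atTop.1 hb
  refine ⟨max (4 + |Real.logb 2 (c ^ 2)| + (c ^ 2 * 2 ^ κ / 4 + 4) / Real.log 2)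
    (gaussianCapacity (2 ^ κ * 2 ^ M)), fun m hm P h σ2 hP hh hσ hle => ?_⟩
  have hn : 0 < ‖h‖ := norm_pos_iff.2 hh
  have hsnr : 0 < snr P h σ2 := by unfold snr; positivity
  have hsm : snr P h σ2 ≤ 2 ^ κ * 2 ^ m := by
    have : Real.logb 2 (snr P h σ2) ≤ κ + m := by linarith
    rwa [Real.logb_le_iff_le_rpow (by norm_num) hsnr, Real.rpow_add (by norm_num),
      Real.rpow_natCast] at this
  rcases le_total M m with hMm | hMm
  · obtain ⟨h0, hs, -⟩ := hM m hMm
    exact (APSK.gap_le_of_separated ((hA.isAPSK m hm).normalized h0) hc hs hP hh hσ hsm).trans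
      (le_max_left _ _)
  · -- For the finitely many remaining `m` the capacity itself is bounded.
    refine le_trans ?_ (le_max_right _ _)
    have hI := mutualInfo_nonneg ((A m).normalized m).points P h hσ
    have hcap : gaussianCapacity (snr P h σ2) ≤ gaussianCapacity (2 ^ κ * 2 ^ M) := by
      unfold gaussianCapacity
      gcongr
      · norm_num
      · refine hsm.trans ?_
        gcongr
        norm_num
    linarith
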